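/- Let $\Omega$ be a finite set with $n=|\Omega|\ge 2$ elements, identified with $\{1,\dots,n\}$, and let $d=(d_1,\dots,d_n)$ be a probability distribution on $\Omega$ with $d_i>0$ for all $i$. Let $d^\downarrow$ be the rearrangement of $d$ in non-increasing order. For $1\le i<j\le n$ let $P^{d^\downarrow}(i,j)$ be the $n\times n$ matrix whose restriction to the rows and columns $i,j$ is $$\begin{pmatrix}1-\gamma&1\\ \gamma&0\end{pmatrix},\qquad \gamma=\frac{d^\downarrow_j}{d^\downarrow_i},$$ and which agrees with the identity matrix in all other entries; put $P^{d^\downarrow}(i,i)=\mathbb I$. A $d$-swap is a matrix of the form $Q^{T}P^{d^\downarrow}(i,j)\,Q$, where $1\le i\le j\le n$ and $Q$ is a permutation matrix with $Qd=d^\downarrow$. A $T^d$-transform is a matrix of the form $(1-\lambda)\mathbb I+\lambda P$, where $P$ is a $d$-swap and $0\le\lambda\le 1$. Let $\mathcal P_{\mathrm{WETO}}(d)$ be the set of all real $n\times n$ matrices that are products of finitely many $T^d$-transforms. Then the following statements are equivalent: (a) $\mathcal P_{\mathrm{WETO}}(d)$ is a convex subset of the space of real $n\times n$ matrices. (b)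 $|\Omega|=2$. -/

import Mathlib

open scoped Matrix

noncomputable section

/-- The swap matrix `P^e(i,j)` for a vector `e` arranged in non-increasing order and `i ≤ j`.
With `γ = e j / e i`, it has the block `(1 - γ, 1; γ, 0)` in the rows and columns `i, j`, and it is
the identity elsewhere. For `i = j` (no pair of levels is involved) it is the identity. -/
def sortedSwap {n : ℕ} (e : Fin n → ℝ) (i j : Fin n) : Matrix (Fin n) (Fin n) ℝ :=
  if i = j then 1
  else Matrix.of fun k l =>
    if k = i ∧ l = i then 1 - e j / e i
    else if k = i ∧ l = j then 1
    else if k = j ∧ l = i then e j / e i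
    else if k = j ∧ l = j then 0
    else (1 : Matrix (Fin n) (Fin n) ℝ) k l

/-- `P` is a `d`-swap: `P = Qᵀ P^{Qd}(i,j) Q` with `i ≤ j` and `Q` a permutation matrix such that
`Q d` is the non-increasing rearrangement of `d`. -/
def IsDSwap {n : ℕ} (d : Fin n → ℝ) (P : Matrix (Fin n) (Fin n) ℝ) : Prop :=
  ∃ (σ : Equiv.Perm (Fin n)) (i j : Fin n), i ≤ j ∧
    Antitone (σ.permMatrix ℝ *ᵥ d) ∧
    P = (σ.permMatrix ℝ)ᵀ * sortedSwap (σ.permMatrix ℝ *ᵥ d) i j * σ.permMatrix ℝ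

/-- `T` is a `T^d`-transform: `T = (1 - t) I + t P` with `0 ≤ t ≤ 1` and `P` a `d`-swap. -/
def IsTdTransform {n : ℕ} (d : Fin n → ℝ) (T : Matrix (Fin n) (Fin n) ℝ) : Prop :=
  ∃ (t : ℝ) (P : Matrix (Fin n) (Fin n) ℝ), 0 ≤ t ∧ t ≤ 1 ∧ IsDSwap d P ∧
    T = (1 - t) • (1 : Matrix (Fin n) (Fin n) ℝ) + t • P

/-- The polytope of weak elementary thermal operations: the set of all matrices that are products
of finite sequences of `T^d`-transforms. -/
def wetoPolytope {n : ℕ} (d : Fin n → ℝ) : Set (Matrix (Fin n) (Fin n) ℝ) :=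
  {M | ∃ L : List (Matrix (Fin n) (Fin n) ℝ), (∀ T ∈ L, IsTdTransform d T) ∧ M = L.prod}

end

/-! Non-convexity for `n ≥ 3` comes from an invariant of supports. Left multiplication by a
transform mixes two rows of a nonnegative matrix: either it leaves the rows unchanged or merely
exchanges them, or one new row has support containing that of the other. Hence every product
satisfies `HasComparableRowsOrSparse`. If `c` has least weight, the midpoint of the swaps `(a, c)`
and `(b, c)` has row supports `{a, c}`, `{b, c}`, `{a, b}` and singletons `{k}` for the other `k`,
which violates this. For `n = 2` there is one nontrivial swap `S`; since `S * S` is a convex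
combination of `S` and `1`, the segment from `1` to `S` is closed under products and equals the
whole set. -/

theorem sortedSwap_self {n : ℕ} (e : Fin n → ℝ) (i : Fin n) : sortedSwap e i i = 1 := by
  simp [sortedSwap]

theorem permMatrix_mulVec_eq_comp {n : ℕ} (σ : Equiv.Perm (Fin n)) (d : Fin n → ℝ) :
    σ.permMatrix ℝ *ᵥ d = d ∘ σ :=
  PEquiv.toMatrix_toPEquiv_mulVec σ d

/-- Conjugating a sorted swap by the sorting permutation gives a swap in the original labelling. -/
theorem transpose_permMatrix_mul_sortedSwap_mul {n : ℕ} (σ : Equiv.Perm (Fin n)) (d : Fin n → ℝ)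
    (i j : Fin n) :
    (σ.permMatrix ℝ)ᵀ * sortedSwap (d ∘ σ) i j * σ.permMatrix ℝ =
      sortedSwap d (σ i) (σ j) := by
  rw [Matrix.transpose_permMatrix, Equiv.Perm.permMatrix, Equiv.Perm.permMatrix,
    PEquiv.toMatrix_toPEquiv_mul, PEquiv.mul_toMatrix_toPEquiv]
  ext k l
  obtain ⟨k, rfl⟩ := σ.surjective k
  obtain ⟨l, rfl⟩ := σ.surjective l
  by_cases hij : i = j
  · subst hij
    simp [sortedSwap_self, Matrix.one_apply]
  · simp [sortedSwap, hij, Matrix.one_apply]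

/-- Any labelling can be sorted so that `a` precedes `b` whenever `d b ≤ d a`. -/
theorem exists_perm_antitone_le {n : ℕ} (d : Fin n → ℝ) {a b : Fin n} (hab : d b ≤ d a) :
    ∃ (σ : Equiv.Perm (Fin n)) (i j : Fin n), i ≤ j ∧ Antitone (d ∘ σ) ∧ σ i = a ∧ σ j = b := by
  -- The second coordinate breaks ties, placing `b` last in its weight class.
  let key : Fin n → ℝ ×ₗ ℕ := fun k => toLex (-d k, if k = b then 1 else 0)
  have hmono := Tuple.monotone_sort key
  set σ := Tuple.sort key
  have hanti : Antitone (d ∘ σ) := by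
    intro i j hij
    have h := hmono hij
    simp only [key, Function.comp_apply, Prod.Lex.toLex_le_toLex] at h
    rcases h with h | h
    · exact (neg_lt_neg_iff.mp h).le
    · exact (neg_inj.mp h.1).ge
  refine ⟨σ, σ.symm a, σ.symm b, ?_, hanti, by simp, by simp⟩
  by_contra! hlt
  have hne : a ≠ b := by
    rintro rfl
    exact lt_irrefl _ hlt
  have h := hmono hlt.le
  simp only [key, Function.comp_apply, Equiv.apply_symm_apply, Prod.Lex.toLex_le_toLex, hne,
    if_true, if_false] at h
  rcases h with h | h
  · linarith
  · omega

/-- This removes the sorting permutation: conjugation only relabels levels, and ties may be sorted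
in either order. -/
theorem isDSwap_iff {n : ℕ} (d : Fin n → ℝ) (P : Matrix (Fin n) (Fin n) ℝ) :
    IsDSwap d P ↔ ∃ a b, d b ≤ d a ∧ P = sortedSwap d a b := by
  simp only [IsDSwap, permMatrix_mulVec_eq_comp, transpose_permMatrix_mul_sortedSwap_mul]
  constructor
  · rintro ⟨σ, i, j, hij, hσ, rfl⟩
    exact ⟨σ i, σ j, hσ hij, rfl⟩
  · rintro ⟨a, b, hab, rfl⟩
    obtain ⟨σ, i, j, hij, hσ, rfl, rfl⟩ := exists_perm_antitone_le d hab
    exact ⟨σ, i, j, hij, hσ, rfl⟩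

theorem sortedSwap_mul_apply {n : ℕ} (d : Fin n → ℝ) {a b : Fin n} (hab : a ≠ b)
    (N : Matrix (Fin n) (Fin n) ℝ) (k l : Fin n) :
    (sortedSwap d a b * N) k l =
      if k = a then (1 - d b / d a) * N a l + N b l
      else if k = b then d b / d a * N a l else N k l := by
  have hrow : ∀ m, sortedSwap d a b k m =
      if k = a then (1 - d b / d a) * (1 : Matrix (Fin n) (Fin n) ℝ) a m +
        (1 : Matrix (Fin n) (Fin n) ℝ) b m
      else if k = b then d b / d a * (1 : Matrix (Fin n) (Fin n) ℝ) a m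
      else (1 : Matrix (Fin n) (Fin n) ℝ) k m := by
    intro m
    simp only [sortedSwap, if_neg hab, Matrix.of_apply, Matrix.one_apply]
    grind
  simp only [Matrix.mul_apply, hrow]
  split_ifs
  · simp [add_mul, Finset.sum_add_distrib, Matrix.one_apply]
  · simp [Matrix.one_apply]
  · simp [Matrix.one_apply]

/-- The swap matrix is annihilated by a polynomial with roots `1` and `-γ`. -/
theorem sortedSwap_mul_self {n : ℕ} (d : Fin n → ℝ) {a b : Fin n} (hab : a ≠ b) :
    sortedSwap d a b * sortedSwap d a b =
      (1 - d b / d a) • sortedSwap d a b + (d b / d a) • 1 := by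
  have hS : ∀ k l, sortedSwap d a b k l =
      if k = a then (1 - d b / d a) * (1 : Matrix (Fin n) (Fin n) ℝ) a l +
        (1 : Matrix (Fin n) (Fin n) ℝ) b l
      else if k = b then d b / d a * (1 : Matrix (Fin n) (Fin n) ℝ) a l
      else (1 : Matrix (Fin n) (Fin n) ℝ) k l := by
    intro k l
    rw [← sortedSwap_mul_apply d hab 1 k l, mul_one]
  ext k l
  rw [sortedSwap_mul_apply d hab]
  simp only [Matrix.add_apply, Matrix.smul_apply, smul_eq_mul, hS, if_true, hab.symm, if_false]
  split_ifs with h1 h2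
  · subst h1; ring
  · subst h2; ring
  · ring

/-- Either two distinct rows have comparable supports, or every row has at most one nonzero
entry. -/
def HasComparableRowsOrSparse {n : ℕ} (M : Matrix (Fin n) (Fin n) ℝ) : Prop :=
  (∃ i j, i ≠ j ∧ ∀ l, M i l ≠ 0 → M j l ≠ 0) ∨
    ∀ i k l, M i k ≠ 0 → M i l ≠ 0 → k = l

/-- Inductive step of the invariant; nonnegativity is carried along because it excludes cancellation
when rows are mixed. -/
theorem IsTdTransform.mul_hasComparableRowsOrSparse {n : ℕ} {d : Fin n → ℝ}
    (hpos : ∀ i, 0 < d i) {T N : Matrix (Fin n) (Fin n) ℝ} (hT : IsTdTransform d T)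
    (hN : ∀ i j, 0 ≤ N i j) (hN' : HasComparableRowsOrSparse N) :
    (∀ i j, 0 ≤ (T * N) i j) ∧ HasComparableRowsOrSparse (T * N) := by
  obtain ⟨t, P, ht0, ht1, hP, rfl⟩ := hT
  obtain ⟨a, b, hba, rfl⟩ := (isDSwap_iff d P).mp hP
  rcases eq_or_ne a b with rfl | hab
  · simpa [sortedSwap_self, ← add_smul] using And.intro hN hN'
  have hγ0 : 0 < d b / d a := div_pos (hpos b) (hpos a)
  have hγ1 : d b / d a ≤ 1 := (div_le_one (hpos a)).mpr hba
  set γ := d b / d a with hγ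
  have hM : ∀ k l, (((1 - t) • (1 : Matrix (Fin n) (Fin n) ℝ) + t • sortedSwap d a b) * N) k l =
      if k = a then (1 - t * γ) * N a l + t * N b l
      else if k = b then t * γ * N a l + (1 - t) * N b l else N k l := by
    intro k l
    rw [add_mul, smul_mul_assoc, smul_mul_assoc, one_mul, Matrix.add_apply, Matrix.smul_apply,
      Matrix.smul_apply, sortedSwap_mul_apply d hab, ← hγ, smul_eq_mul, smul_eq_mul]
    split_ifs with h1 h2
    · subst h1; ring
    · subst h2; ring
    · ring
  generalize ((1 - t) • (1 : Matrix (Fin n) (Fin n) ℝ) + t • sortedSwap d a b) * N = M at hM ⊢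
  have htγ : 0 ≤ 1 - t * γ := by nlinarith
  have ht1' : 0 ≤ 1 - t := by linarith
  refine ⟨fun k l => ?_, ?_⟩
  · have := hN a l
    have := hN b l
    have := hN k l
    rw [hM]
    split_ifs <;> positivity
  rcases ht0.eq_or_lt with rfl | ht
  · have : M = N := by
      ext k l
      rw [hM]
      split_ifs with h1 h2
      · simp [h1]
      · simp [h2]
      · rfl
    rwa [this]
  rcases htγ.eq_or_lt with h | h
  -- Here `t * γ = 1` forces `t = γ = 1`, so rows `a` and `b` are exchanged and either alternative
  -- for `N` persists.
  · have ht' : t = 1 := by nlinarith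
    have hγ' : γ = 1 := by rw [ht'] at h; linarith
    have hswap : ∀ k l, M k l = N (Equiv.swap a b k) l := by
      intro k l
      rw [hM, ht', hγ', Equiv.swap_apply_def]
      split_ifs <;> simp
    rcases hN' with ⟨i, j, hij, hs⟩ | hs
    · refine Or.inl ⟨Equiv.swap a b i, Equiv.swap a b j, by simpa using hij, fun l => ?_⟩
      simpa [hswap] using hs l
    · right
      intro i k l
      rw [hswap, hswap]
      exact hs _ k l
  -- Both coefficients in the new row `a` are positive, so it vanishes only where rows `a` and `b`
  -- of `N` both vanish.
  · refine Or.inl ⟨b, a, hab.symm, fun l hb ha => hb ?_⟩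
    rw [hM, if_pos rfl] at ha
    rw [hM, if_neg hab.symm, if_pos rfl]
    have h1 : 0 ≤ (1 - t * γ) * N a l := mul_nonneg htγ (hN a l)
    have h2 : 0 ≤ t * N b l := mul_nonneg ht.le (hN b l)
    have h3 : N a l = 0 := (mul_eq_zero.mp (by linarith)).resolve_left h.ne'
    have h4 : N b l = 0 := (mul_eq_zero.mp (by linarith)).resolve_left ht.ne'
    simp [h3, h4]

theorem hasComparableRowsOrSparse_of_mem_wetoPolytope {n : ℕ} {d : Fin n → ℝ}
    (hpos : ∀ i, 0 < d i) {M : Matrix (Fin n) (Fin n) ℝ} (hM : M ∈ wetoPolytope d) :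
    HasComparableRowsOrSparse M := by
  obtain ⟨L, hL, rfl⟩ := hM
  suffices h : (∀ i j, 0 ≤ L.prod i j) ∧ HasComparableRowsOrSparse L.prod from h.2
  induction L with
  | nil =>
    refine ⟨fun i j => ?_, Or.inr fun i k l hk hl => ?_⟩
    · rw [List.prod_nil, Matrix.one_apply]
      split_ifs <;> norm_num
    · simp only [List.prod_nil, Matrix.one_apply, ne_eq, ite_eq_right_iff, one_ne_zero, imp_false,
        not_not] at hk hl
      exact hk.symm.trans hl
  | cons T L ih =>
    obtain ⟨h0, h1⟩ := ih fun S hS => hL S (List.mem_cons_of_mem _ hS)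
    rw [List.prod_cons]
    exact (hL T List.mem_cons_self).mul_hasComparableRowsOrSparse hpos h0 h1

theorem sortedSwap_mem_wetoPolytope {n : ℕ} {d : Fin n → ℝ} {a b : Fin n} (hba : d b ≤ d a) :
    sortedSwap d a b ∈ wetoPolytope d := by
  refine ⟨[sortedSwap d a b], ?_, by simp⟩
  simp only [List.mem_singleton, forall_eq]
  exact ⟨1, _, zero_le_one, le_rfl, (isDSwap_iff d _).mpr ⟨a, b, hba, rfl⟩, by simp⟩

/-- With a third level `c` of least weight, the midpoint of the swaps `(a, c)` and `(b, c)` is not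
a product of transforms. -/
theorem not_convex_wetoPolytope {n : ℕ} {d : Fin n → ℝ} (hpos : ∀ i, 0 < d i) {a b c : Fin n}
    (hab : a ≠ b) (hac : a ≠ c) (hbc : b ≠ c) (hca : d c ≤ d a) (hcb : d c ≤ d b) :
    ¬ Convex ℝ (wetoPolytope d) := by
  intro hconv
  have hmem := hconv (sortedSwap_mem_wetoPolytope hca) (sortedSwap_mem_wetoPolytope hcb)
    (by norm_num : (0 : ℝ) ≤ 1 / 2) (by norm_num : (0 : ℝ) ≤ 1 / 2) (by norm_num)
  have hα0 : 0 < d c / d a := div_pos (hpos c) (hpos a)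
  have hβ0 : 0 < d c / d b := div_pos (hpos c) (hpos b)
  have hα1 : d c / d a ≤ 1 := (div_le_one (hpos a)).mpr hca
  have hβ1 : d c / d b ≤ 1 := (div_le_one (hpos b)).mpr hcb
  have hM : ∀ k l, ((1 / 2 : ℝ) • sortedSwap d a c + (1 / 2 : ℝ) • sortedSwap d b c) k l ≠ 0 ↔
      (k = l ∧ k ≠ c) ∨ (k = a ∧ l = c) ∨ (k = c ∧ l = a) ∨ (k = b ∧ l = c) ∨
        (k = c ∧ l = b) := by
    intro k l
    simp only [Matrix.add_apply, Matrix.smul_apply, smul_eq_mul, sortedSwap, if_neg hac,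
      if_neg hbc, Matrix.of_apply, Matrix.one_apply]
    generalize d c / d a = α at *
    generalize d c / d b = β at *
    split_ifs <;> grind
  rcases hasComparableRowsOrSparse_of_mem_wetoPolytope hpos hmem with ⟨i, j, hij, hs⟩ | hs
  -- Columns `a`, `b`, `c` and the diagonal column `i` suffice to refute every inclusion of row
  -- supports.
  · simp only [hM] at hs
    have ha := hs a
    have hb := hs b
    have hc := hs c
    have hi := hs i
    grind
  · exact hab (hs c a b ((hM _ _).mpr (by simp)) ((hM _ _).mpr (by simp)))

theorem sortedSwap_comm_of_eq {n : ℕ} {d : Fin n → ℝ} (hpos : ∀ i, 0 < d i) {a b : Fin n}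
    (h : d a = d b) : sortedSwap d a b = sortedSwap d b a := by
  rcases eq_or_ne a b with rfl | hab
  · rfl
  · ext k l
    have := (hpos b).ne'
    simp only [sortedSwap, if_neg hab, if_neg hab.symm, h, div_self this, Matrix.of_apply,
      Matrix.one_apply]
    grind

theorem mul_mem_segment_one_sortedSwap {n : ℕ} {d : Fin n → ℝ} (hpos : ∀ i, 0 < d i) {a b : Fin n}
    (hab : a ≠ b) (hba : d b ≤ d a) {T N : Matrix (Fin n) (Fin n) ℝ}
    (hT : T ∈ segment ℝ 1 (sortedSwap d a b)) (hN : N ∈ segment ℝ 1 (sortedSwap d a b)) :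
    T * N ∈ segment ℝ 1 (sortedSwap d a b) := by
  have hγ0 : 0 < d b / d a := div_pos (hpos b) (hpos a)
  have hγ1 : 0 ≤ 1 - d b / d a := sub_nonneg.mpr ((div_le_one (hpos a)).mpr hba)
  have hsq := sortedSwap_mul_self d hab
  set γ := d b / d a
  set S := sortedSwap d a b
  obtain ⟨p, q, hp, hq, hpq, rfl⟩ := hT
  obtain ⟨r, s, hr, hs, hrs, rfl⟩ := hN
  -- Coefficients of `1` and `S` in `(p + q S)(r + s S)` after reducing `S * S` by `hsq`; they sum
  -- to `(p + q)(r + s) = 1`.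
  refine ⟨p * r + q * s * γ, p * s + q * r + q * s * (1 - γ), by positivity, by positivity, ?_, ?_⟩
  · linear_combination r * hpq + s * hpq + hrs
  · simp only [add_mul, mul_add, smul_mul_assoc, mul_smul_comm, one_mul, mul_one, hsq]
    module

theorem wetoPolytope_two_eq_segment {d : Fin 2 → ℝ} (hpos : ∀ i, 0 < d i) {a b : Fin 2}
    (hab : a ≠ b) (hba : d b ≤ d a) :
    wetoPolytope d = segment ℝ 1 (sortedSwap d a b) := by
  have hswap : ∀ P, IsDSwap d P → P = 1 ∨ P = sortedSwap d a b := by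
    intro P hP
    obtain ⟨i, j, hij, rfl⟩ := (isDSwap_iff d P).mp hP
    have hcases : i = j ∨ (i = a ∧ j = b) ∨ (i = b ∧ j = a) := by omega
    rcases hcases with rfl | ⟨rfl, rfl⟩ | ⟨rfl, rfl⟩
    · exact Or.inl (sortedSwap_self d i)
    · exact Or.inr rfl
    -- The reversed pair is admissible only when the weights are equal, and then it gives the same
    -- swap.
    · exact Or.inr (sortedSwap_comm_of_eq hpos (le_antisymm hba hij))
  apply Set.Subset.antisymm
  · rintro M ⟨L, hL, rfl⟩
    induction L with
    | nil => exact left_mem_segment ℝ _ _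
    | cons T L ih =>
      rw [List.prod_cons]
      refine mul_mem_segment_one_sortedSwap hpos hab hba ?_
        (ih fun S hS => hL S (List.mem_cons_of_mem _ hS))
      obtain ⟨t, P, ht0, ht1, hP, rfl⟩ := hL T List.mem_cons_self
      rcases hswap P hP with rfl | rfl
      · rw [← add_smul, sub_add_cancel, one_smul]
        exact left_mem_segment ℝ _ _
      · exact ⟨1 - t, t, by linarith, ht0, by ring, rfl⟩
  · rintro M ⟨s, t, hs, ht, hst, rfl⟩
    refine ⟨[s • 1 + t • sortedSwap d a b], ?_, by simp⟩
    simp only [List.mem_singleton, forall_eq]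
    exact ⟨t, _, ht, by linarith, (isDSwap_iff d _).mpr ⟨a, b, hba, rfl⟩, by
      rw [← hst, add_sub_cancel_right]⟩

theorem mainTheorem9 (n : ℕ) (hn : 2 ≤ n) (d : Fin n → ℝ)
    (hd : d ∈ stdSimplex ℝ (Fin n)) (hpos : ∀ i, 0 < d i) :
    Convex ℝ (wetoPolytope d) ↔ n = 2 := by
  constructor
  · intro hconv
    by_contra hne
    have : Nonempty (Fin n) := ⟨⟨0, by omega⟩⟩
    obtain ⟨c, hc⟩ := Finite.exists_min d
    have hcard : 1 < (Finset.univ.erase c).card := by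
      rw [Finset.card_erase_of_mem (Finset.mem_univ c), Finset.card_univ, Fintype.card_fin]
      omega
    obtain ⟨a, ha, b, hb, hab⟩ := Finset.one_lt_card.mp hcard
    exact not_convex_wetoPolytope hpos hab (Finset.ne_of_mem_erase ha) (Finset.ne_of_mem_erase hb)
      (hc a) (hc b) hconv
  · rintro rfl
    rcases le_total (d 1) (d 0) with h | h
    · rw [wetoPolytope_two_eq_segment hpos zero_ne_one h]
      exact convex_segment _ _
    · rw [wetoPolytope_two_eq_segment hpos one_ne_zero h]
      exact convex_segment _ _
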